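/- Let $n \in \mathbb{N}$, let $H \in \mathbb{C}^{2^n \times 2^n}$ be positive semidefinite, $H \neq 0$, let $\psi \in \mathbb{C}^{2^n}$ with $\|\psi\| = 1$, and let $t > 0$, $\epsilon, \delta \in (0,1]$ and $K, M \in \mathbb{N}$. Let $t_1, \dots, t_M$ be independent random indices in $\{1, \dots, 2^n\}$, each with law $p(q) = H_{qq}/\operatorname{tr} H$. Let $A \in \mathbb{C}^{2^n \times M}$ and $B \in \mathbb{C}^{M \times M}$ be given by $A_{ij} = H_{i,t_j}$ and $B_{ij} = H_{t_i,t_j}$, let $B^\dagger$ be the Moore–Penrose pseudoinverse of $B$, and put $D = B^\dagger A^* A$ and $v = B^\dagger A^* \psi$. Define $$b_0 = \frac{(it)^K}{K!}\, v, \qquad b_j = \frac{(it)^{K-j}}{(K-j)!}\, v + D\, b_{j-1} \quad (1 \le j \le K-1), \qquad \widehat\psi_{K,M}(t) = \psi + A\, b_{K-1}.$$ Thus $\widehat\psi_{K,M}(t) = \psi + g_K(\widehat H)\widehat H \psi$, where $\widehat H = A B^\dagger A^*$ is the Nyström approximation of $H$ and $g_K(x) = \sum_{k=1}^{K} \frac{(it)^k}{k!}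 x^{k-1}$ keeps the first $K$ terms of the series of $g(x) = (e^{itx}-1)/x$. If $$K \ge e\,t\,\|H\| + \log\frac{2}{\epsilon} \qquad\text{and}\qquad M \ge \max\left(405 \operatorname{tr} H,\ \frac{72\, t \operatorname{tr} H}{\epsilon} \log\frac{36\, t \operatorname{tr} H}{\epsilon\delta}\right),$$ where $\|H\|$ is the spectral norm, then with probability at least $1-\delta$ $$\left\| e^{iHt}\psi - \widehat\psi_{K,M}(t) \right\| \le \epsilon .$$ -/

import Mathlib

open MeasureTheory ProbabilityTheory Matrix
open scoped ComplexOrder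

noncomputable section

namespace NystromSim

/-- The Moore–Penrose pseudoinverse `X† = (X* X)† X*` of a complex matrix. Here `(X* X)†` inverts the
nonzero eigenvalues of the Hermitian matrix `X* X` and keeps the zero ones (`0⁻¹ = 0`). The four
defining equations are proved in `pinv_spec`. -/
def pinv {m k : Type*} [Fintype m] [Fintype k] [DecidableEq k] (X : Matrix m k ℂ) :
    Matrix k m ℂ :=
  cfc (fun x : ℝ => x⁻¹) (Xᴴ * X) * Xᴴ

/-- The Moore–Penrose equations, which determine the pseudoinverse uniquely. -/
theorem pinv_spec {m k : Type*} [Fintype m] [Fintype k] [DecidableEq k] (X : Matrix m k ℂ) :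
    X * pinv X * X = X ∧ pinv X * X * pinv X = pinv X ∧
      (X * pinv X)ᴴ = X * pinv X ∧ (pinv X * X)ᴴ = pinv X * X := by
  set G : Matrix k k ℂ := Xᴴ * X with hG
  set P : Matrix k k ℂ := cfc (fun x : ℝ => x⁻¹) G with hP
  have hGs : IsSelfAdjoint G := (isHermitian_conjTranspose_mul_self X)
  have hfin : (spectrum ℝ G).Finite := Matrix.finite_real_spectrum
  have hc : ∀ f : ℝ → ℝ, ContinuousOn f (spectrum ℝ G) := fun f => hfin.continuousOn f
  have hid : cfc (fun x : ℝ => x) G = G := cfc_id' ℝ G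
  have hPs : Pᴴ = P := (cfc_predicate (fun x : ℝ => x⁻¹) G : IsSelfAdjoint P)
  have hGh : Gᴴ = G := hGs
  have hPG : P * G = cfc (fun x : ℝ => x⁻¹ * x) G := by
    rw [cfc_mul _ _ G (hc _) (hc _), hid]
  have hGP : G * P = P * G := by
    rw [hPG, hP]
    conv_lhs => rw [← hid]
    rw [cfc_congr (g := fun x : ℝ => x⁻¹) (a := cfc (fun x : ℝ => x) G) (fun _ _ => rfl)]
    rw [hid]
    conv_lhs => arg 1; rw [← hid]
    rw [← cfc_mul _ _ G (hc _) (hc _)]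
    exact cfc_congr fun x _ => mul_comm _ _
  have hGPG : G * P * G = G := by
    rw [mul_assoc, hPG]
    conv_lhs => arg 1; rw [← hid]
    rw [← cfc_mul _ _ G (hc _) (hc _)]
    conv_rhs => rw [← hid]
    exact cfc_congr fun x _ => by
      by_cases h : x = 0 <;> simp [h]
  have hPGP : P * G * P = P := by
    rw [hPG]
    conv_lhs => arg 2; rw [hP]
    rw [← cfc_mul _ _ G (hc _) (hc _)]
    exact cfc_congr fun x _ => by
      by_cases h : x = 0 <;> simp [h]
  have hpinv : pinv X = P * Xᴴ := rfl
  have key : X * P * G = X := by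
    have h0 : (X * P * G - X)ᴴ * (X * P * G - X) = 0 := by
      have e : (X * P * G - X)ᴴ * (X * P * G - X)
          = G * P * G * P * G - G * P * G - (G * P * G - G) := by
        simp only [conjTranspose_sub, conjTranspose_mul, hPs, hGh, Matrix.sub_mul, Matrix.mul_sub]
        simp only [hG, Matrix.mul_assoc]
      rw [e, hGPG, hGPG]; simp
    exact sub_eq_zero.mp (conjTranspose_mul_self_eq_zero.mp h0)
  refine ⟨?_, ?_, ?_, ?_⟩
  · rw [hpinv, ← Matrix.mul_assoc, Matrix.mul_assoc (X * P)]; exact key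
  · rw [hpinv, Matrix.mul_assoc P, ← hG, ← Matrix.mul_assoc (P * G), hPGP]
  · rw [hpinv]; simp only [conjTranspose_mul, conjTranspose_conjTranspose, hPs, Matrix.mul_assoc]
  · rw [hpinv, Matrix.mul_assoc, ← hG, conjTranspose_mul, hPs, hGh, hGP]

variable {ι : Type*} [Fintype ι] [DecidableEq ι]

/-- The spectral norm of a square complex matrix: the operator norm for the Euclidean norm. -/
def specNorm (H : Matrix ι ι ℂ) : ℝ := ‖Matrix.toEuclideanCLM (n := ι) (𝕜 := ℂ) H‖

/-- The exact evolution `ψ(t) = exp(i H t) ψ`. -/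
def evolve (H : Matrix ι ι ℂ) (t : ℝ) (ψ : EuclideanSpace ℂ ι) : EuclideanSpace ℂ ι :=
  WithLp.toLp 2 (NormedSpace.exp ((Complex.I * (t : ℂ)) • H) *ᵥ ψ.ofLp)

/-- The sampling probability `p(q) = H_{qq} / tr H` of an index `q` (the diagonal entries and the
trace of a positive semidefinite matrix are real). -/
def sampleProb (H : Matrix ι ι ℂ) (q : ι) : ℝ := (H q q).re / H.trace.re

/-- The random indices `T j`, `j : Fin M`, are independent, and each has law `p`. -/
structure IsDiagonalSample {Ω : Type*} [MeasurableSpace Ω] [MeasurableSpace ι] {M : ℕ}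
    (μ : Measure Ω) (H : Matrix ι ι ℂ) (T : Fin M → Ω → ι) : Prop where
  measurable : ∀ j, Measurable (T j)
  indep : iIndepFun T μ
  law : ∀ j q, μ.real {ω | T j ω = q} = sampleProb H q

/-- The matrix `A` of the sampled columns, `A_{i,j} = H_{i, T_j}`. -/
def colMatrix {M : ℕ} (H : Matrix ι ι ℂ) (T : Fin M → ι) : Matrix ι (Fin M) ℂ :=
  Matrix.of fun i j => H i (T j)

/-- The matrix `B` of the sampled rows and columns, `B_{i,j} = H_{T_i, T_j}`. -/
def blockMatrix {M : ℕ} (H : Matrix ι ι ℂ) (T : Fin M → ι) : Matrix (Fin M) (Fin M) ℂ :=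
  Matrix.of fun i j => H (T i) (T j)

/-- The iterates `b_0 = ((it)^K / K!) v` and `b_j = ((it)^(K-j) / (K-j)!) v + D b_{j-1}`, so that
`b_{K-1} = g_K(D) v`, where `g_K` keeps the first `K` terms of
`g(x) = (e^{itx} - 1)/x = ∑_{k ≥ 1} (it)^k x^(k-1) / k!`. -/
def iter {M : ℕ} (D : Matrix (Fin M) (Fin M) ℂ) (v : Fin M → ℂ) (t : ℝ) (K : ℕ) :
    ℕ → (Fin M → ℂ)
  | 0 => ((Complex.I * (t : ℂ)) ^ K / (K.factorial : ℂ)) • v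
  | j + 1 => ((Complex.I * (t : ℂ)) ^ (K - (j + 1)) / ((K - (j + 1)).factorial : ℂ)) • v
      + D *ᵥ iter D v t K j

/-- The output `ψ + A b_{K-1}` of the algorithm on the sampled indices `T`,
with `D = B† A* A` and `v = B† (A* ψ)`. -/
def output {M : ℕ} (H : Matrix ι ι ℂ) (T : Fin M → ι) (t : ℝ) (K : ℕ)
    (ψ : EuclideanSpace ℂ ι) : EuclideanSpace ℂ ι :=
  let A := colMatrix H T
  let Bp := pinv (blockMatrix H T)
  let D := Bp * Aᴴ * A
  let v := Bp *ᵥ (Aᴴ *ᵥ ψ.ofLp)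
  WithLp.toLp 2 (ψ.ofLp + A *ᵥ iter D v t K (K - 1))

end NystromSim

end

/-!
The error splits into three parts. Truncating the exponential series after the term of degree `K`
costs at most `exp (e t ‖H‖ - (K + 1)) ≤ ε / 2`, because the Nyström approximation `N = A B† A*`
satisfies `‖N‖ ≤ ‖H‖` (`norm_exp_sub_sum_le`). Replacing `H` by `N` in the unitary evolution costs at
most `t ‖H - N‖` by Duhamel's formula (`norm_exp_sub_exp_le`). It remains to see that
`‖H - N‖ ≤ ε / (2 t)` with probability at least `1 - δ`.

No matrix concentration inequality is needed for this. Write `H = S²` with `S` Hermitian. The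
residual is `S Q S`, where `Q` projects onto the complement of the span of the sampled columns of
`S`, and its norm is at most that of `Z = C H C`, where `C` is the projection produced by
Gram–Schmidt on these columns (`norm_sub_nystrom_le_deflation`). Drawing one more index `q`
compresses `Z` by `1 - u u*`, where `u` is the normalized vector `C s_q`. For the potential
`φ Z = tr (Z - c)₊`, the trace Jensen inequality gives
`φ ((1 - u u*) Z (1 - u u*)) ≤ φ Z - u* (Z - c)₊ u` (`potential_compress_le`). Under the law
`p q = ‖s_q‖² / tr H` the loss is on average at least `tr ((Z - c)₊ Z) / tr H ≥ c φ Z / tr H`,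
because `‖C s_q‖ ≤ ‖s_q‖`. So the expected potential after `M` draws is at most
`exp (- c M / tr H) tr H` (`expected_potential_le`). With `c = ε / (6 t)`, Markov's inequality gives
`φ Z ≤ 2 c` with probability at least `1 - δ`, and `Z ≤ c + φ Z` finishes the argument.
-/

namespace NystromSim

section

open scoped MatrixOrder Matrix.Norms.L2Operator

/-! ### The trace of the part of a Hermitian matrix above a threshold -/

variable {ι : Type*} [Fintype ι]

theorem re_trace_nonneg {A : Matrix ι ι ℂ} (hA : 0 ≤ A) : 0 ≤ A.trace.re :=
  (Complex.nonneg_iff.mp (nonneg_iff_posSemidef.mp hA).trace_nonneg).1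

theorem re_trace_mono {A B : Matrix ι ι ℂ} (h : A ≤ B) : A.trace.re ≤ B.trace.re := by
  have := re_trace_nonneg (sub_nonneg.mpr h)
  rw [trace_sub, Complex.sub_re] at this
  linarith

variable [DecidableEq ι]

/-- The positive part `(Z - c)₊` of a Hermitian matrix `Z` above the threshold `c`. -/
noncomputable def excess (c : ℝ) (Z : Matrix ι ι ℂ) : Matrix ι ι ℂ :=
  cfc (fun x : ℝ => max (x - c) 0) Z

/-- The potential `tr (Z - c)₊`. -/
noncomputable def potential (c : ℝ) (Z : Matrix ι ι ℂ) : ℝ := (excess c Z).trace.re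

/-- Every real function is continuous on the finite spectrum of a matrix. -/
theorem continuousOn_spectrum (f : ℝ → ℝ) (Z : Matrix ι ι ℂ) : ContinuousOn f (spectrum ℝ Z) :=
  Matrix.finite_real_spectrum.continuousOn f

theorem excess_nonneg (c : ℝ) (Z : Matrix ι ι ℂ) : 0 ≤ excess c Z :=
  cfc_nonneg fun _ _ => le_max_right _ _

theorem potential_nonneg (c : ℝ) (Z : Matrix ι ι ℂ) : 0 ≤ potential c Z :=
  re_trace_nonneg (excess_nonneg c Z)

theorem cfc_sub_const_eq (c : ℝ) {Z : Matrix ι ι ℂ} (hZ : IsSelfAdjoint Z) :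
    cfc (fun x : ℝ => x - c) Z = Z - algebraMap ℝ _ c := by
  rw [cfc_sub _ _ Z (continuousOn_spectrum _ Z) (continuousOn_spectrum _ Z), cfc_id' ℝ Z,
    cfc_const c Z]

theorem sub_le_excess (c : ℝ) {Z : Matrix ι ι ℂ} (hZ : IsSelfAdjoint Z) :
    Z - algebraMap ℝ _ c ≤ excess c Z := by
  rw [← cfc_sub_const_eq c hZ]
  exact cfc_mono (fun x _ => le_max_left _ _) (continuousOn_spectrum _ Z) (continuousOn_spectrum _ Z)

theorem excess_le_self {c : ℝ} (hc : 0 ≤ c) {Z : Matrix ι ι ℂ} (hZ : 0 ≤ Z) : excess c Z ≤ Z := by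
  have hs : IsSelfAdjoint Z := .of_nonneg hZ
  conv_rhs => rw [← cfc_id' ℝ Z]
  refine cfc_mono (fun x hx => max_le (by linarith) (spectrum_nonneg_of_nonneg hZ hx))
    (continuousOn_spectrum _ Z) (continuousOn_spectrum _ Z)

theorem potential_le_trace {c : ℝ} (hc : 0 ≤ c) {Z : Matrix ι ι ℂ} (hZ : 0 ≤ Z) :
    potential c Z ≤ Z.trace.re :=
  re_trace_mono (excess_le_self hc hZ)

/-- `(Z - c)₊` lives where `Z ≥ c`. This turns the loss in the compression inequality into a
geometric decay rate. -/
theorem mul_potential_le (c : ℝ) {Z : Matrix ι ι ℂ} (hZ : IsSelfAdjoint Z) :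
    c * potential c Z ≤ (excess c Z * Z).trace.re := by
  have h : c • excess c Z ≤ excess c Z * Z := by
    have e1 : c • excess c Z = cfc (fun x : ℝ => c * max (x - c) 0) Z :=
      (cfc_const_mul c _ Z (continuousOn_spectrum _ Z)).symm
    have e2 : excess c Z * Z = cfc (fun x : ℝ => max (x - c) 0 * x) Z := by
      rw [cfc_mul _ _ Z (continuousOn_spectrum _ Z) (continuousOn_spectrum _ Z), cfc_id' ℝ Z]
      rfl
    rw [e1, e2]
    refine cfc_mono (fun x _ => ?_) (continuousOn_spectrum _ Z) (continuousOn_spectrum _ Z)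
    rcases le_total x c with h | h
    · simp [max_eq_right (sub_nonpos.mpr h)]
    · rw [mul_comm]
      exact mul_le_mul_of_nonneg_left h (le_max_right _ _)
  simpa [potential] using re_trace_mono h

/-- A positive semidefinite matrix is dominated by its trace. -/
theorem le_trace_smul_one {A : Matrix ι ι ℂ} (hA : 0 ≤ A) :
    A ≤ algebraMap ℝ _ A.trace.re := by
  have hs : IsSelfAdjoint A := .of_nonneg hA
  have hp : A.PosSemidef := nonneg_iff_posSemidef.mp hA
  refine le_algebraMap_of_spectrum_le (fun {x} hx => ?_)
  rw [hp.1.spectrum_real_eq_range_eigenvalues] at hx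
  obtain ⟨i, rfl⟩ := hx
  rw [hp.1.trace_eq_sum_eigenvalues]
  simp only [Complex.re_sum]
  exact Finset.single_le_sum (f := fun i => hp.1.eigenvalues i)
    (fun i _ => hp.eigenvalues_nonneg i) (Finset.mem_univ i)

theorem le_add_potential (c : ℝ) {Z : Matrix ι ι ℂ} (hZ : IsSelfAdjoint Z) :
    Z ≤ algebraMap ℝ _ (c + potential c Z) := by
  have h := (sub_le_excess c hZ).trans (le_trace_smul_one (excess_nonneg c Z))
  rw [sub_le_iff_le_add] at h
  rwa [add_comm, map_add]

theorem re_trace_mul_nonneg {A B : Matrix ι ι ℂ} (hA : 0 ≤ A) (hB : 0 ≤ B) :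
    0 ≤ (A * B).trace.re := by
  obtain ⟨R, rfl⟩ := CStarAlgebra.nonneg_iff_eq_star_mul_self.mp hB
  rw [← mul_assoc, trace_mul_comm, ← mul_assoc]
  exact re_trace_nonneg (star_right_conjugate_nonneg hA R)

/-- `(Z - c)₊` has the smallest trace among all positive semidefinite matrices above `Z - c`:
compress to the spectral projection of `Z` for `(c, ∞)`. -/
theorem potential_le_of_le {c : ℝ} {Z G : Matrix ι ι ℂ} (hZ : IsSelfAdjoint Z) (hG : 0 ≤ G)
    (h : Z - algebraMap ℝ _ c ≤ G) : potential c Z ≤ G.trace.re := by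
  set P : Matrix ι ι ℂ := cfc (fun x : ℝ => if c < x then 1 else 0) Z with hP
  have hPs : star P = P := (cfc_predicate _ Z : IsSelfAdjoint P)
  have hPP : P * P = P := by
    rw [hP, ← cfc_mul _ _ Z (continuousOn_spectrum _ Z) (continuousOn_spectrum _ Z)]
    exact cfc_congr fun x _ => by split_ifs <;> simp
  have hP1 : P ≤ 1 := cfc_le_one _ _ fun x _ => by split_ifs <;> simp
  have hF : excess c Z = P * (Z - algebraMap ℝ _ c) * star P := by
    rw [hPs, ← cfc_sub_const_eq c hZ, hP,
      ← cfc_mul _ _ Z (continuousOn_spectrum _ Z) (continuousOn_spectrum _ Z),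
      ← cfc_mul _ _ Z (continuousOn_spectrum _ Z) (continuousOn_spectrum _ Z)]
    refine cfc_congr fun x _ => ?_
    split_ifs with hx
    · simp [hx.le]
    · simp [not_lt.mp hx]
  have h1 : potential c Z ≤ (P * G * star P).trace.re := by
    rw [potential, hF]
    exact re_trace_mono (star_right_conjugate_le_conjugate h P)
  have h2 : (P * G * star P).trace = (G * P).trace := by
    rw [hPs, trace_mul_comm, ← mul_assoc, hPP, trace_mul_comm]
  have h3 := re_trace_mul_nonneg hG (sub_nonneg.mpr hP1)
  rw [mul_sub, mul_one, trace_sub, Complex.sub_re] at h3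
  rw [h2] at h1
  linarith

/-- Trace Jensen inequality for compression by the projection `1 - U` and the convex function
`x ↦ (x - c)₊`, with the loss `tr (U (Z - c)₊)` kept. -/
theorem potential_compress_le {c : ℝ} (hc : 0 ≤ c) {Z U : Matrix ι ι ℂ} (hZ : IsSelfAdjoint Z)
    (hU : star U = U) (hUU : U * U = U) :
    potential c ((1 - U) * Z * (1 - U)) ≤ potential c Z - (U * excess c Z).trace.re := by
  have hV : star (1 - U) = 1 - U := by rw [star_sub, star_one, hU]
  have hVV : (1 - U) * (1 - U) = 1 - U := by
    simp only [mul_sub, sub_mul, mul_one, one_mul, hUU]; abel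
  have hU0 : 0 ≤ U := by rw [← hUU]; nth_rw 1 [← hU]; exact star_mul_self_nonneg U
  have hZ' : IsSelfAdjoint ((1 - U) * Z * (1 - U)) := by
    rw [isSelfAdjoint_iff, star_mul, star_mul, hV, hZ.star_eq, mul_assoc]
  have hG : 0 ≤ (1 - U) * excess c Z * (1 - U) := by
    have := star_right_conjugate_nonneg (excess_nonneg c Z) (1 - U)
    rwa [hV] at this
  have key : (1 - U) * Z * (1 - U) - algebraMap ℝ _ c ≤ (1 - U) * excess c Z * (1 - U) := by
    have h1 := star_right_conjugate_le_conjugate (sub_le_excess c hZ) (1 - U)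
    rw [hV] at h1
    refine le_trans ?_ h1
    have e : ∀ V : Matrix ι ι ℂ, V * V = V →
        V * (Z - algebraMap ℝ _ c) * V = V * Z * V - c • V := fun V h => by
      rw [mul_sub, sub_mul, Algebra.algebraMap_eq_smul_one, mul_smul_comm, mul_one,
        smul_mul_assoc, h]
    rw [e _ hVV, smul_sub, Algebra.algebraMap_eq_smul_one]
    exact sub_le_sub_left (sub_le_self _ (smul_nonneg hc hU0)) _
  refine (potential_le_of_le hZ' hG key).trans_eq ?_
  rw [trace_mul_comm, ← mul_assoc, hVV, sub_mul, one_mul, trace_sub, Complex.sub_re]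
  rfl

end

section

open scoped MatrixOrder Matrix.Norms.L2Operator

variable {ι : Type*} [Fintype ι] [DecidableEq ι]

/-! ### Deflation by the sampled columns of the square root -/

/-- The orthogonal projection `w w* / (w* w)` onto the line spanned by the column `w` of index `q`
of `G`; it is `0` if that column vanishes. -/
noncomputable def colProj (G : Matrix ι ι ℂ) (q : ι) : Matrix ι ι ℂ :=
  ((Gᴴ * G) q q)⁻¹ • (G * Matrix.single q q 1 * Gᴴ)

/-- The orthogonal projection that kills the columns `x 0, …, x (j - 1)` of `S`, built by
Gram–Schmidt: each step removes the direction in which the next column sticks out of the span of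
the previous ones. -/
noncomputable def deflation (S : Matrix ι ι ℂ) : (j : ℕ) → (Fin j → ι) → Matrix ι ι ℂ
  | 0, _ => 1
  | j + 1, x => deflation S j (Fin.init x) -
      colProj (deflation S j (Fin.init x) * S) (x (Fin.last j))

theorem star_colProj (G : Matrix ι ι ℂ) (q : ι) : star (colProj G q) = colProj G q := by
  have h : star ((Gᴴ * G) q q) = (Gᴴ * G) q q :=
    (isHermitian_conjTranspose_mul_self G).apply q q
  simp only [colProj, star_eq_conjTranspose, conjTranspose_smul, conjTranspose_mul,
    conjTranspose_conjTranspose, conjTranspose_single, star_one, star_inv₀, h, Matrix.mul_assoc]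

theorem colProj_mul_self (G : Matrix ι ι ℂ) (q : ι) :
    colProj G q * colProj G q = colProj G q := by
  have h : G * Matrix.single q q 1 * Gᴴ * (G * Matrix.single q q 1 * Gᴴ)
      = (Gᴴ * G) q q • (G * Matrix.single q q 1 * Gᴴ) := by
    have e : Matrix.single q q (1 : ℂ) * (Gᴴ * G) * Matrix.single q q 1
        = (Gᴴ * G) q q • Matrix.single q q 1 := by
      rw [single_mul_mul_single, one_mul, mul_one, smul_single, smul_eq_mul, mul_one]
    calc _ = G * (Matrix.single q q (1 : ℂ) * (Gᴴ * G) * Matrix.single q q 1) * Gᴴ := by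
            simp only [Matrix.mul_assoc]
      _ = _ := by rw [e, Matrix.mul_smul, Matrix.smul_mul]
  rw [colProj, smul_mul_smul_comm, h, smul_smul]
  congr 1
  by_cases h0 : (Gᴴ * G) q q = 0
  · simp [h0]
  · field_simp

theorem trace_colProj_mul (G F : Matrix ι ι ℂ) (q : ι) :
    (colProj G q * F).trace = ((Gᴴ * G) q q)⁻¹ * (Gᴴ * F * G) q q := by
  rw [colProj, smul_mul, trace_smul, smul_eq_mul, Matrix.mul_assoc, Matrix.mul_assoc,
    trace_mul_comm, Matrix.mul_assoc, trace_single_mul, one_smul]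

theorem mul_colProj_mul {C : Matrix ι ι ℂ} (hC : C * C = C) (S : Matrix ι ι ℂ) (q : ι) :
    C * colProj (C * S) q = colProj (C * S) q := by
  simp only [colProj, Matrix.mul_smul, ← Matrix.mul_assoc, hC]

theorem colProj_mul_mul {C : Matrix ι ι ℂ} (hs : star C = C) (hC : C * C = C)
    (S : Matrix ι ι ℂ) (q : ι) : colProj (C * S) q * C = colProj (C * S) q := by
  have h := congrArg star (mul_colProj_mul hC S q)
  rwa [star_mul, star_colProj, hs] at h

theorem star_deflation (S : Matrix ι ι ℂ) :
    ∀ (j : ℕ) (x : Fin j → ι), star (deflation S j x) = deflation S j x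
  | 0, _ => star_one _
  | j + 1, x => by rw [deflation, star_sub, star_deflation S j, star_colProj]

theorem deflation_mul_self (S : Matrix ι ι ℂ) :
    ∀ (j : ℕ) (x : Fin j → ι), deflation S j x * deflation S j x = deflation S j x
  | 0, _ => one_mul _
  | j + 1, x => by
    have h := deflation_mul_self S j (Fin.init x)
    rw [deflation, mul_sub, sub_mul, sub_mul, h, mul_colProj_mul h,
      colProj_mul_mul (star_deflation S j _) h, colProj_mul_self]
    abel

/-- Only the span of the chosen columns is removed: a matrix that kills these columns does not see
the deflation. -/
theorem mul_deflation_eq (S Q : Matrix ι ι ℂ) :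
    ∀ (j : ℕ) (x : Fin j → ι), (∀ i, Q * S * Matrix.single (x i) (x i) 1 = 0) →
      Q * deflation S j x = Q
  | 0, _, _ => mul_one _
  | j + 1, x, h => by
    have h1 : Q * deflation S j (Fin.init x) = Q := mul_deflation_eq S Q j _ fun i => h i.castSucc
    have h2 : ∀ G : Matrix ι ι ℂ, Q * (deflation S j (Fin.init x) * S *
        Matrix.single (x (Fin.last j)) (x (Fin.last j)) 1 * G) = 0 := fun G => by
      rw [← Matrix.mul_assoc, ← Matrix.mul_assoc, ← Matrix.mul_assoc, h1, h (Fin.last j),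
        Matrix.zero_mul]
    rw [deflation, mul_sub, h1, colProj, Matrix.mul_smul, h2, smul_zero, sub_zero]

/-- One-step drift for a single index: the deflation direction `w = C s_q` is at most as long as the
column `s_q`, so weighting by `H q q = ‖s_q‖²` cancels its normalization. -/
theorem mul_potential_deflate_le {c : ℝ} (hc : 0 ≤ c) {S C : Matrix ι ι ℂ} (hS : star S = S)
    (hs : star C = C) (hC : C * C = C) (q : ι) :
    ((S * S) q q).re * potential c ((C - colProj (C * S) q) * (S * S) * (C - colProj (C * S) q)) ≤
      ((S * S) q q).re * potential c (C * (S * S) * C) -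
        (((C * S)ᴴ * excess c (C * (S * S) * C) * (C * S)) q q).re := by
  set U := colProj (C * S) q with hU
  set Z := C * (S * S) * C with hZ
  set F := excess c Z with hF
  have hZs : IsSelfAdjoint Z := by
    rw [isSelfAdjoint_iff, hZ, star_mul, star_mul, star_mul, hs, hS]; simp only [mul_assoc]
  have e : (C - U) * (S * S) * (C - U) = (1 - U) * Z * (1 - U) := by
    have e1 : C - U = (1 - U) * C := by rw [sub_mul, one_mul, hU, colProj_mul_mul hs hC]
    have e2 : C - U = C * (1 - U) := by rw [mul_sub, mul_one, hU, mul_colProj_mul hC]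
    nth_rw 1 [e1]
    rw [e2, hZ]
    simp only [mul_assoc]
  rw [e]
  have h1 := potential_compress_le hc hZs (star_colProj (C * S) q) (colProj_mul_self (C * S) q)
  have hF0 : 0 ≤ F := excess_nonneg c Z
  set G := C * S with hG
  have hγ : 0 ≤ (Gᴴ * F * G) q q :=
    (nonneg_iff_posSemidef.mp (star_left_conjugate_nonneg hF0 G)).diag_nonneg
  have hβ : 0 ≤ (Gᴴ * G) q q := (posSemidef_conjTranspose_mul_self G).diag_nonneg
  have hC1 : C ≤ 1 := by
    have h : 0 ≤ star (1 - C) * (1 - C) := star_mul_self_nonneg _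
    rw [star_sub, star_one, hs] at h
    simpa [mul_sub, sub_mul, hC] using h
  have hβα : (Gᴴ * G) q q ≤ (S * S) q q := by
    have h := star_left_conjugate_le_conjugate hC1 S
    have h' := (le_iff.mp h).diag_nonneg (i := q)
    have e3 : star S * C * S = Gᴴ * G := by
      have : Cᴴ = C := hs
      rw [hG, conjTranspose_mul, this, Matrix.mul_assoc Sᴴ, ← Matrix.mul_assoc C, hC,
        ← Matrix.mul_assoc]
      rfl
    rw [e3, mul_one, hS, Matrix.sub_apply] at h'
    exact sub_nonneg.mp h'
  have hγβ : (Gᴴ * F * G) q q ≤ (F.trace.re : ℂ) * (Gᴴ * G) q q := by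
    have h := star_left_conjugate_le_conjugate (le_trace_smul_one hF0) G
    have h' := (le_iff.mp h).diag_nonneg (i := q)
    have e3 : star G * algebraMap ℝ _ F.trace.re * G = (F.trace.re : ℂ) • (Gᴴ * G) := by
      rw [Algebra.algebraMap_eq_smul_one, mul_smul_comm, mul_one, smul_mul_assoc]
      rfl
    rw [e3, Matrix.sub_apply, Matrix.smul_apply, smul_eq_mul] at h'
    exact sub_nonneg.mp h'
  have htr := trace_colProj_mul G F q
  rw [← hU] at htr
  obtain ⟨b, hb⟩ : ∃ b : ℝ, (Gᴴ * G) q q = b :=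
    ⟨_, (Complex.ext rfl (Complex.nonneg_iff.mp hβ).2.symm)⟩
  obtain ⟨g, hg⟩ : ∃ g : ℝ, (Gᴴ * F * G) q q = g :=
    ⟨_, (Complex.ext rfl (Complex.nonneg_iff.mp hγ).2.symm)⟩
  obtain ⟨a, ha⟩ : ∃ a : ℝ, (S * S) q q = a :=
    ⟨_, (Complex.ext rfl (Complex.nonneg_iff.mp (hβ.trans hβα)).2.symm)⟩
  rw [hb, hg, ← Complex.ofReal_inv, ← Complex.ofReal_mul] at htr
  rw [htr, Complex.ofReal_re] at h1
  rw [hb] at hβ hβα hγβ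
  rw [hg] at hγ hγβ ⊢
  rw [ha] at hβα ⊢
  norm_cast at hβ hβα hγβ hγ
  rw [Complex.ofReal_re, Complex.ofReal_re]
  have h2 : g ≤ a * (b⁻¹ * g) := by
    rcases hβ.eq_or_lt with h0 | h0
    · rw [← h0, mul_zero] at hγβ
      rw [le_antisymm hγβ hγ]; simp
    · have : 1 ≤ a * b⁻¹ := by rw [← div_eq_mul_inv, one_le_div h0]; exact hβα
      rw [← mul_assoc]
      exact le_mul_of_one_le_left hγ this
  have h3 := mul_le_mul_of_nonneg_left h1 (hβ.trans hβα)
  rw [mul_sub a] at h3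
  exact h3.trans (sub_le_sub_left h2 _)

/-- Averaged over the diagonal sampling law, one deflation step shrinks the potential by the factor
`1 - c / tr H`. -/
theorem sum_mul_potential_deflate_le {c : ℝ} (hc : 0 ≤ c) {S C : Matrix ι ι ℂ} (hS : star S = S)
    (hs : star C = C) (hC : C * C = C) :
    ∑ q, ((S * S) q q).re *
        potential c ((C - colProj (C * S) q) * (S * S) * (C - colProj (C * S) q)) ≤
      ((S * S).trace.re - c) * potential c (C * (S * S) * C) := by
  refine (Finset.sum_le_sum fun q _ => mul_potential_deflate_le hc hS hs hC q).trans ?_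
  have hZs : IsSelfAdjoint (C * (S * S) * C) := by
    rw [isSelfAdjoint_iff, star_mul, star_mul, star_mul, hs, hS]; simp only [mul_assoc]
  have h1 : ∑ q, (((C * S)ᴴ * excess c (C * (S * S) * C) * (C * S)) q q).re
      = (excess c (C * (S * S) * C) * (C * (S * S) * C)).trace.re := by
    have e : ((C * S)ᴴ * excess c (C * (S * S) * C) * (C * S)).trace
        = (excess c (C * (S * S) * C) * (C * (S * S) * C)).trace := by
      rw [Matrix.mul_assoc, trace_mul_comm]
      have hs' : Cᴴ = C := hs
      have hS' : Sᴴ = S := hS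
      rw [conjTranspose_mul, hs', hS']
      simp only [Matrix.mul_assoc]
    rw [← e, trace, Complex.re_sum]
    rfl
  rw [Finset.sum_sub_distrib, h1, ← Finset.sum_mul, sub_mul]
  have h2 : ∑ q, ((S * S) q q).re = (S * S).trace.re := by rw [trace, Complex.re_sum]; rfl
  rw [h2]
  linarith [mul_potential_le c hZs]

/-! ### The expected potential after `M` samples -/

theorem sampleProb_nonneg {ι : Type*} [Fintype ι] {H : Matrix ι ι ℂ}
    (hH : H.PosSemidef) (q : ι) : 0 ≤ sampleProb H q :=
  div_nonneg (Complex.nonneg_iff.mp hH.diag_nonneg).1 (Complex.nonneg_iff.mp hH.trace_nonneg).1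

/-- The expected potential after `j` independent draws decays geometrically. The sum runs over all
tuples of indices, weighted by their product probabilities; the last draw is averaged first. -/
theorem expected_potential_le {c : ℝ} (hc : 0 ≤ c) {S : Matrix ι ι ℂ} (hS : star S = S)
    (htr : 0 < (S * S).trace.re) (j : ℕ) :
    ∑ x : Fin j → ι, (∏ i, sampleProb (S * S) (x i)) *
        potential c (deflation S j x * (S * S) * deflation S j x) ≤
      Real.exp (-c / (S * S).trace.re) ^ j * (S * S).trace.re := by
  have hH : 0 ≤ S * S := by nth_rw 1 [← hS]; exact star_mul_self_nonneg S
  induction j with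
  | zero => simpa [deflation] using potential_le_trace hc hH
  | succ j ih =>
    set τ := (S * S).trace.re with hτ
    have step : ∀ x : Fin j → ι, ∑ q, sampleProb (S * S) q *
          potential c ((deflation S j x - colProj (deflation S j x * S) q) * (S * S) *
            (deflation S j x - colProj (deflation S j x * S) q)) ≤
        Real.exp (-c / τ) * potential c (deflation S j x * (S * S) * deflation S j x) := by
      intro x
      have h := sum_mul_potential_deflate_le hc hS (star_deflation S j x) (deflation_mul_self S j x)
      have h' := div_le_div_of_nonneg_right h htr.le
      rw [Finset.sum_div] at h'
      have he : 1 - c / τ ≤ Real.exp (-c / τ) := by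
        have := Real.add_one_le_exp (-c / τ)
        rw [neg_div] at this ⊢
        linarith
      calc _ = _ := Finset.sum_congr rfl fun q _ => div_mul_eq_mul_div _ _ _
        _ ≤ _ := h'
        _ = (1 - c / τ) * potential c (deflation S j x * (S * S) * deflation S j x) := by
            rw [← hτ]; field_simp
        _ ≤ _ := mul_le_mul_of_nonneg_right he (potential_nonneg _ _)
    rw [← (Fin.snocEquiv fun _ => ι).sum_comp, Fintype.sum_prod_type_right]
    calc _ = ∑ x : Fin j → ι, (∏ i, sampleProb (S * S) (x i)) * ∑ q, sampleProb (S * S) q *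
          potential c ((deflation S j x - colProj (deflation S j x * S) q) * (S * S) *
            (deflation S j x - colProj (deflation S j x * S) q)) := by
            refine Finset.sum_congr rfl fun x _ => ?_
            rw [Finset.mul_sum]
            refine Finset.sum_congr rfl fun q _ => ?_
            rw [Fin.prod_univ_castSucc]
            simp [Fin.snocEquiv, deflation, mul_assoc]
      _ ≤ ∑ x : Fin j → ι, (∏ i, sampleProb (S * S) (x i)) *
          (Real.exp (-c / τ) * potential c (deflation S j x * (S * S) * deflation S j x)) :=
            Finset.sum_le_sum fun x _ => mul_le_mul_of_nonneg_left (step x)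
              (Finset.prod_nonneg fun i _ => sampleProb_nonneg (nonneg_iff_posSemidef.mp hH) _)
      _ = Real.exp (-c / τ) * ∑ x : Fin j → ι, (∏ i, sampleProb (S * S) (x i)) *
          potential c (deflation S j x * (S * S) * deflation S j x) := by
            rw [Finset.mul_sum]
            exact Finset.sum_congr rfl fun x _ => by ring
      _ ≤ Real.exp (-c / τ) * (Real.exp (-c / τ) ^ j * τ) :=
            mul_le_mul_of_nonneg_left ih (Real.exp_pos _).le
      _ = _ := by ring

end

/-! ### Exponentials -/

/-- Tail of the exponential series: for `‖a‖ ≤ r` the terms of index at least `m` sum to at most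
`e^(e r - m)`, since `r ^ k ≤ e ^ (-m) (e r) ^ k` for `k ≥ m`. -/
theorem norm_exp_sub_sum_le {A : Type*} [NormedRing A] [NormedAlgebra ℂ A] [CompleteSpace A]
    [NormOneClass A] (a : A) {r : ℝ} (hr : ‖a‖ ≤ r) (m : ℕ) :
    ‖NormedSpace.exp a - ∑ k ∈ Finset.range m, ((k.factorial : ℂ)⁻¹) • a ^ k‖ ≤
      Real.exp (Real.exp 1 * r - m) := by
  have hr0 : 0 ≤ r := (norm_nonneg a).trans hr
  have hs : HasSum (fun k : ℕ => ((k.factorial : ℂ)⁻¹) • a ^ k) (NormedSpace.exp a) :=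
    NormedSpace.exp_series_hasSum_exp' a
  have ht := (hasSum_nat_add_iff' m).mpr hs
  have he : HasSum (fun k : ℕ => (Real.exp 1 * r) ^ k / (k.factorial : ℝ))
      (Real.exp (Real.exp 1 * r)) := by
    rw [Real.exp_eq_exp_ℝ]; exact NormedSpace.expSeries_div_hasSum_exp _
  have he' : Summable fun k : ℕ => (Real.exp 1 * r) ^ (k + m) / ((k + m).factorial : ℝ) :=
    (summable_nat_add_iff m).mpr he.summable
  have hle : ∑' k : ℕ, (Real.exp 1 * r) ^ (k + m) / ((k + m).factorial : ℝ) ≤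
      Real.exp (Real.exp 1 * r) := by
    rw [← he.tsum_eq]
    exact tsum_comp_le_tsum_of_inj he.summable (fun k => by positivity) (add_left_injective m)
  have hterm : ∀ k : ℕ, ‖(((k + m).factorial : ℂ)⁻¹) • a ^ (k + m)‖ ≤
      Real.exp (-m) * ((Real.exp 1 * r) ^ (k + m) / ((k + m).factorial : ℝ)) := by
    intro k
    rw [norm_smul, norm_inv, Complex.norm_natCast, mul_pow, ← Real.exp_nat_mul, mul_one]
    have h1 : ‖a ^ (k + m)‖ ≤ r ^ (k + m) :=
      (norm_pow_le a _).trans (pow_le_pow_left₀ (norm_nonneg a) hr _)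
    have h2 : (1 : ℝ) ≤ Real.exp (-m) * Real.exp ((k + m : ℕ) : ℝ) := by
      rw [← Real.exp_add]; apply Real.one_le_exp; push_cast; linarith [(k.cast_nonneg : (0 : ℝ) ≤ k)]
    calc _ ≤ ((k + m).factorial : ℝ)⁻¹ * r ^ (k + m) := by gcongr
      _ ≤ (Real.exp (-m) * Real.exp ((k + m : ℕ) : ℝ)) *
          (((k + m).factorial : ℝ)⁻¹ * r ^ (k + m)) :=
            le_mul_of_one_le_left (by positivity) h2
      _ = _ := by ring
  have hb := tsum_of_norm_bounded (he'.hasSum.mul_left (Real.exp (-m))) hterm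
  rw [ht.tsum_eq] at hb
  refine hb.trans ?_
  rw [sub_eq_add_neg, Real.exp_add, mul_comm]
  exact mul_le_mul_of_nonneg_right hle (Real.exp_pos _).le

theorem norm_exp_I_smul_le {A : Type*} [CStarAlgebra A] {a : A}
    (ha : IsSelfAdjoint a) (s : ℝ) : ‖NormedSpace.exp ((Complex.I * (s : ℂ)) • a)‖ ≤ 1 := by
  have h : NormedSpace.exp ((Complex.I * (s : ℂ)) • a) ∈ unitary A := by
    have h0 : IsSelfAdjoint ((s : ℂ) • a) := by
      rw [isSelfAdjoint_iff, star_smul, ha.star_eq]; simp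
    have := (selfAdjoint.expUnitary ⟨_, h0⟩).2
    rwa [selfAdjoint.expUnitary_coe, smul_smul] at this
  rcases subsingleton_or_nontrivial A with h0 | h0
  · rw [Subsingleton.elim (NormedSpace.exp _) (0 : A), norm_zero]; exact zero_le_one
  · exact (CStarRing.norm_of_mem_unitary h).le

/-- Duhamel's estimate: the unitary groups of two self-adjoint elements diverge at most at the
rate `‖a - b‖`. -/
theorem norm_exp_sub_exp_le {A : Type*} [CStarAlgebra A] {a b : A}
    (ha : IsSelfAdjoint a) (hb : IsSelfAdjoint b) {t : ℝ} (ht : 0 ≤ t) :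
    ‖NormedSpace.exp ((Complex.I * (t : ℂ)) • a) - NormedSpace.exp ((Complex.I * (t : ℂ)) • b)‖ ≤
      t * ‖a - b‖ := by
  have hd : ∀ (x : A) (s : ℝ), HasDerivAt
      (fun s : ℝ => NormedSpace.exp ((Complex.I * (s : ℂ)) • x))
      (NormedSpace.exp ((Complex.I * (s : ℂ)) • x) * (Complex.I • x)) s := fun x s => by
    have h := hasDerivAt_exp_smul_const (𝕂 := ℝ) (Complex.I • x) s
    have e : ∀ u : ℝ, u • (Complex.I • x) = (Complex.I * (u : ℂ)) • x := fun u => by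
      rw [mul_comm, mul_smul]; rfl
    simpa only [e] using h
  have hd' : ∀ (x : A) (s : ℝ), HasDerivAt
      (fun s : ℝ => NormedSpace.exp ((Complex.I * ((t - s : ℝ) : ℂ)) • x))
      (-((Complex.I • x) * NormedSpace.exp ((Complex.I * ((t - s : ℝ) : ℂ)) • x))) s :=
    fun x s => by
    have h := (hasDerivAt_exp_smul_const' (𝕂 := ℝ) (Complex.I • x) (t - s)).scomp s
      ((hasDerivAt_id s).const_sub t)
    have e : ∀ u : ℝ, u • (Complex.I • x) = (Complex.I * (u : ℂ)) • x := fun u => by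
      rw [mul_comm, mul_smul]; rfl
    simp only [e, Function.comp_def, neg_smul, one_smul] at h
    exact h
  have hmain : ∀ s : ℝ, HasDerivAt
      (fun s : ℝ => NormedSpace.exp ((Complex.I * (s : ℂ)) • a) *
        NormedSpace.exp ((Complex.I * ((t - s : ℝ) : ℂ)) • b))
      (NormedSpace.exp ((Complex.I * (s : ℂ)) • a) * (Complex.I • (a - b)) *
        NormedSpace.exp ((Complex.I * ((t - s : ℝ) : ℂ)) • b)) s := fun s => by
    refine ((hd a s).mul (hd' b s)).congr_deriv ?_
    rw [smul_sub, mul_sub, sub_mul, mul_neg, ← mul_assoc, ← sub_eq_add_neg]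
  have hbound : ∀ s ∈ Set.Ico (0 : ℝ) t, ‖NormedSpace.exp ((Complex.I * (s : ℂ)) • a) *
      (Complex.I • (a - b)) * NormedSpace.exp ((Complex.I * ((t - s : ℝ) : ℂ)) • b)‖ ≤
        ‖a - b‖ := fun s _ => by
    calc _ ≤ ‖NormedSpace.exp ((Complex.I * (s : ℂ)) • a)‖ * ‖Complex.I • (a - b)‖ *
          ‖NormedSpace.exp ((Complex.I * ((t - s : ℝ) : ℂ)) • b)‖ := norm_mul₃_le
      _ ≤ 1 * ‖a - b‖ * 1 := by
          gcongr
          · exact norm_exp_I_smul_le ha s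
          · rw [norm_smul, Complex.norm_I, one_mul]
          · exact norm_exp_I_smul_le hb (t - s)
      _ = _ := by ring
  have h := norm_image_sub_le_of_norm_deriv_le_segment' (fun s _ => (hmain s).hasDerivWithinAt)
    hbound t (Set.right_mem_Icc.mpr ht)
  simpa [NormedSpace.exp_zero, mul_comm] using h

section

open scoped MatrixOrder Matrix.Norms.L2Operator

variable {ι : Type*} [Fintype ι] [DecidableEq ι]

/-! ### The Nyström approximation -/

/-- The Nyström approximation `A B† A*` of `H` on the sampled indices. -/
noncomputable def nystrom {M : ℕ} (H : Matrix ι ι ℂ) (x : Fin M → ι) : Matrix ι ι ℂ :=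
  colMatrix H x * pinv (blockMatrix H x) * (colMatrix H x)ᴴ

/-- If `P` is a generalized inverse of `X* X`, then `X P X*` is the orthogonal projection onto the
range of `X`. -/
theorem isStarProjection_of_generalizedInverse {m κ : Type*} [Fintype m] [Fintype κ]
    [DecidableEq κ] (X : Matrix m κ ℂ) (P : Matrix κ κ ℂ) (h : Xᴴ * X * P * (Xᴴ * X) = Xᴴ * X) :
    IsStarProjection (X * P * Xᴴ) ∧ X * P * Xᴴ * X = X := by
  have key : ∀ R : Matrix κ κ ℂ, Xᴴ * X * R * (Xᴴ * X) = Xᴴ * X → X * R * Xᴴ * X = X := by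
    intro R hR
    have h1 : Xᴴ * (X * R * Xᴴ * X - X) = 0 := by
      rw [Matrix.mul_sub, sub_eq_zero]
      simpa only [Matrix.mul_assoc] using hR
    have h2 : (X * R * Xᴴ * X - X)ᴴ * (X * R * Xᴴ * X - X) = 0 := by
      have e : (X * R * Xᴴ * X - X)ᴴ = ((R * Xᴴ * X)ᴴ - 1) * Xᴴ := by
        rw [conjTranspose_sub, Matrix.mul_assoc X, Matrix.mul_assoc X, conjTranspose_mul X,
          Matrix.sub_mul, Matrix.one_mul]
      rw [e, Matrix.mul_assoc, h1, Matrix.mul_zero]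
    exact sub_eq_zero.mp (conjTranspose_mul_self_eq_zero.mp h2)
  have h1 := key P h
  have h2 : X * Pᴴ * Xᴴ * X = X := by
    refine key Pᴴ ?_
    have := congrArg conjTranspose h
    simpa only [conjTranspose_mul, conjTranspose_conjTranspose, Matrix.mul_assoc] using this
  -- `Π* Π = Π` for `Π = X P X*`, so `Π` is Hermitian, and then idempotent.
  have h3 : (X * P * Xᴴ)ᴴ * (X * P * Xᴴ) = X * P * Xᴴ := by
    rw [conjTranspose_mul, conjTranspose_mul, conjTranspose_conjTranspose, ← Matrix.mul_assoc X,
      ← Matrix.mul_assoc, ← Matrix.mul_assoc, h2]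
  have h4 : (X * P * Xᴴ)ᴴ = X * P * Xᴴ := by
    have := congrArg conjTranspose h3
    rw [conjTranspose_mul, conjTranspose_conjTranspose, h3] at this
    exact this.symm
  rw [h4] at h3
  exact ⟨⟨h3, h4⟩, h1⟩

/-- With `H = S²`, the Nyström residual is `S Q S`, where the projection `Q` kills the sampled
columns of `S`. -/
theorem exists_projection_nystrom {M : ℕ} {S : Matrix ι ι ℂ} (hS : star S = S) (x : Fin M → ι) :
    ∃ Q : Matrix ι ι ℂ, IsStarProjection Q ∧ nystrom (S * S) x = S * (1 - Q) * S ∧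
      ∀ i, Q * S * Matrix.single (x i) (x i) 1 = 0 := by
  have hS' : Sᴴ = S := hS
  set X : Matrix ι (Fin M) ℂ := S.submatrix id x with hX
  have hXH : Xᴴ = S.submatrix x id := by rw [hX, conjTranspose_submatrix, hS']
  have hA : colMatrix (S * S) x = S * X := by
    ext i j; simp [colMatrix, hX, Matrix.mul_apply]
  have hB : blockMatrix (S * S) x = Xᴴ * X := by
    rw [hXH, hX]; ext i j; simp [blockMatrix, Matrix.mul_apply]
  obtain ⟨hR₀, hRX⟩ := isStarProjection_of_generalizedInverse X (pinv (blockMatrix (S * S) x))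
    (by rw [← hB]; exact (pinv_spec _).1)
  refine ⟨1 - X * pinv (blockMatrix (S * S) x) * Xᴴ, hR₀.one_sub, ?_, fun i => ?_⟩
  · rw [nystrom, hA, conjTranspose_mul, hS', sub_sub_cancel]
    simp only [Matrix.mul_assoc]
  · have h0 : (1 - X * pinv (blockMatrix (S * S) x) * Xᴴ) * X = 0 := by
      rw [Matrix.sub_mul, hRX, Matrix.one_mul, sub_self]
    ext a b
    have h1 : ((1 - X * pinv (blockMatrix (S * S) x) * Xᴴ) * S : Matrix ι ι ℂ) a (x i) = 0 := by
      have := congrFun (congrFun h0 a) i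
      rw [Matrix.mul_apply] at this ⊢
      simpa [hX] using this
    by_cases hb : b = x i
    · subst hb; simpa using h1
    · simp [Matrix.mul_single_apply_of_ne _ _ _ _ _ hb]

theorem norm_mul_self_of_star_eq {S : Matrix ι ι ℂ} (hS : star S = S) :
    ‖S * S‖ = ‖S‖ * ‖S‖ := by
  nth_rw 1 [← hS]
  exact CStarRing.norm_star_mul_self

theorem norm_mul_projection_mul_le {S Q : Matrix ι ι ℂ} (hS : star S = S)
    (hQ : IsStarProjection Q) : ‖S * Q * S‖ ≤ ‖S * S‖ := by
  rw [norm_mul_self_of_star_eq hS]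
  refine norm_mul₃_le.trans ?_
  have := mul_le_mul_of_nonneg_left hQ.norm_le (norm_nonneg S)
  rw [mul_one] at this
  exact mul_le_mul_of_nonneg_right this (norm_nonneg S)

theorem isSelfAdjoint_nystrom {M : ℕ} {S : Matrix ι ι ℂ} (hS : star S = S) (x : Fin M → ι) :
    IsSelfAdjoint (nystrom (S * S) x) := by
  obtain ⟨Q, hQ, hN, -⟩ := exists_projection_nystrom hS x
  rw [isSelfAdjoint_iff, hN, star_mul, star_mul, hS, hQ.one_sub.isSelfAdjoint.star_eq, mul_assoc]

theorem norm_nystrom_le {M : ℕ} {S : Matrix ι ι ℂ} (hS : star S = S) (x : Fin M → ι) :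
    ‖nystrom (S * S) x‖ ≤ ‖S * S‖ := by
  obtain ⟨Q, hQ, hN, -⟩ := exists_projection_nystrom hS x
  rw [hN]
  exact norm_mul_projection_mul_le hS hQ.one_sub

theorem norm_sub_nystrom_le {M : ℕ} {S : Matrix ι ι ℂ} (hS : star S = S) (x : Fin M → ι) :
    ‖S * S - nystrom (S * S) x‖ ≤ ‖S * S‖ := by
  obtain ⟨Q, hQ, hN, -⟩ := exists_projection_nystrom hS x
  have e : S * S - nystrom (S * S) x = S * Q * S := by
    rw [hN, mul_sub, sub_mul, mul_one, sub_sub_cancel]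
  rw [e]
  exact norm_mul_projection_mul_le hS hQ

/-- The Nyström residual is controlled by the deflated matrix: the projection `Q` of the residual
satisfies `Q = Q C` for the deflation `C`, and `‖C S‖² = ‖C S² C‖`. -/
theorem norm_sub_nystrom_le_deflation {M : ℕ} {S : Matrix ι ι ℂ} (hS : star S = S)
    (x : Fin M → ι) :
    ‖S * S - nystrom (S * S) x‖ ≤ ‖deflation S M x * (S * S) * deflation S M x‖ := by
  obtain ⟨Q, hQ, hN, hx⟩ := exists_projection_nystrom hS x
  set C := deflation S M x with hC
  have hCs : star C = C := star_deflation S M x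
  have hQC : Q * C = Q := mul_deflation_eq S Q M x hx
  have e : S * S - nystrom (S * S) x = star (Q * S) * (Q * S) := by
    rw [hN, mul_sub, sub_mul, mul_one, sub_sub_cancel, star_mul, hS,
      hQ.isSelfAdjoint.star_eq, mul_assoc, mul_assoc, ← mul_assoc Q Q, hQ.isIdempotentElem.eq]
  have e' : C * (S * S) * C = C * S * star (C * S) := by
    rw [star_mul, hS, hCs]; simp only [mul_assoc]
  have h : ‖Q * S‖ ≤ ‖C * S‖ := by
    rw [← hQC, mul_assoc]
    refine (norm_mul_le _ _).trans (mul_le_of_le_one_left (norm_nonneg _) ?_)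
    exact hQ.norm_le
  rw [e, e', CStarRing.norm_star_mul_self, CStarRing.norm_self_mul_star]
  exact mul_self_le_mul_self (norm_nonneg _) h

theorem norm_sub_nystrom_le_potential {c : ℝ} (hc : 0 ≤ c) {M : ℕ} {S : Matrix ι ι ℂ}
    (hS : star S = S) (x : Fin M → ι) :
    ‖S * S - nystrom (S * S) x‖ ≤
      c + potential c (deflation S M x * (S * S) * deflation S M x) := by
  refine (norm_sub_nystrom_le_deflation hS x).trans ?_
  have h0 : 0 ≤ deflation S M x * (S * S) * deflation S M x := by
    have h := mul_star_self_nonneg (deflation S M x * S)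
    rw [star_mul, hS, star_deflation] at h
    simpa only [mul_assoc] using h
  rw [CStarAlgebra.norm_le_iff_le_algebraMap _ (add_nonneg hc (potential_nonneg _ _)) h0]
  exact le_add_potential c (.of_nonneg h0)

theorem norm_le_re_trace {H : Matrix ι ι ℂ} (hH : 0 ≤ H) : ‖H‖ ≤ H.trace.re :=
  (CStarAlgebra.norm_le_iff_le_algebraMap _ (re_trace_nonneg hH) hH).mpr (le_trace_smul_one hH)

/-! ### The output is the truncated exponential series of the Nyström approximation -/

/-- `A b_j` as a polynomial in the Nyström approximation `A P A*`, from `A D = (A P A*) A`. -/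
theorem mulVec_iter {M : ℕ} (A : Matrix ι (Fin M) ℂ) (P : Matrix (Fin M) (Fin M) ℂ)
    (t : ℝ) (K : ℕ) (w : ι → ℂ) (j : ℕ) (hj : j ≤ K) :
    A *ᵥ iter (P * Aᴴ * A) (P *ᵥ (Aᴴ *ᵥ w)) t K j =
      (∑ i ∈ Finset.range (j + 1), ((Complex.I * (t : ℂ)) ^ (K - j + i) /
        ((K - j + i).factorial : ℂ)) • (A * P * Aᴴ) ^ (i + 1)) *ᵥ w := by
  induction j with
  | zero => simp [iter, mulVec_smul, smul_mulVec, mulVec_mulVec, Matrix.mul_assoc]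
  | succ j ih =>
    have e : ∀ y, A *ᵥ ((P * Aᴴ * A) *ᵥ y) = (A * P * Aᴴ) *ᵥ (A *ᵥ y) := fun y => by
      simp only [mulVec_mulVec, Matrix.mul_assoc]
    rw [iter, mulVec_add, e, ih (by omega), Finset.sum_range_succ' _ (j + 1), add_mulVec,
      add_comm, mulVec_mulVec, Finset.mul_sum]
    congr 2
    · refine Finset.sum_congr rfl fun i _ => ?_
      rw [Matrix.mul_smul, ← pow_succ', show K - (j + 1) + (i + 1) = K - j + i by omega]
    · simp [mulVec_smul, smul_mulVec, mulVec_mulVec, Matrix.mul_assoc]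

theorem output_eq {M : ℕ} (H : Matrix ι ι ℂ) (x : Fin M → ι) (t : ℝ) {K : ℕ} (hK : 1 ≤ K)
    (ψ : EuclideanSpace ℂ ι) :
    output H x t K ψ = WithLp.toLp 2 ((∑ k ∈ Finset.range (K + 1),
      ((k.factorial : ℂ)⁻¹) • ((Complex.I * (t : ℂ)) • nystrom H x) ^ k) *ᵥ ψ.ofLp) := by
  rw [output]
  simp only
  rw [mulVec_iter _ _ _ _ _ _ (Nat.sub_le K 1), Nat.sub_add_cancel hK, Finset.sum_range_succ' _ K,
    add_mulVec, add_comm]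
  congr 3
  · refine Finset.sum_congr rfl fun i _ => ?_
    rw [smul_pow, smul_smul, show K - (K - 1) + i = i + 1 by omega, div_eq_inv_mul]
    rfl
  · simp

/-- Deterministic error bound: the approximation error of the Hamiltonian, propagated by
Duhamel's estimate, plus the truncation error of the exponential series. -/
theorem norm_evolve_sub_output_le {M : ℕ} {S : Matrix ι ι ℂ} (hS : star S = S) (x : Fin M → ι)
    {t : ℝ} (ht : 0 ≤ t) {K : ℕ} (hK : 1 ≤ K) (ψ : EuclideanSpace ℂ ι) (hψ : ‖ψ‖ = 1) :
    ‖evolve (S * S) t ψ - output (S * S) x t K ψ‖ ≤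
      t * ‖S * S - nystrom (S * S) x‖ +
        Real.exp (Real.exp 1 * (t * specNorm (S * S)) - (K + 1 : ℕ)) := by
  have hι : Nonempty ι := by
    by_contra h
    rw [not_nonempty_iff] at h
    rw [Subsingleton.elim ψ 0, norm_zero] at hψ
    exact zero_ne_one hψ
  have hH : IsSelfAdjoint (S * S) := by rw [isSelfAdjoint_iff, star_mul, hS]
  set N := nystrom (S * S) x with hN
  set Y := ∑ k ∈ Finset.range (K + 1),
      ((k.factorial : ℂ)⁻¹) • ((Complex.I * (t : ℂ)) • N) ^ k with hY
  set E := NormedSpace.exp ((Complex.I * (t : ℂ)) • (S * S)) with hE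
  have e : evolve (S * S) t ψ - output (S * S) x t K ψ = WithLp.toLp 2 ((E - Y) *ᵥ ψ.ofLp) := by
    rw [output_eq _ _ _ hK, evolve, sub_mulVec, WithLp.toLp_sub]
  rw [e]
  refine (l2_opNorm_mulVec (E - Y) ψ).trans ?_
  rw [hψ, mul_one]
  have h1 := norm_exp_sub_exp_le hH (isSelfAdjoint_nystrom hS x) ht
  have h2 : ‖(Complex.I * (t : ℂ)) • N‖ ≤ t * specNorm (S * S) := by
    rw [norm_smul, norm_mul, Complex.norm_I, one_mul, Complex.norm_real, Real.norm_of_nonneg ht]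
    exact mul_le_mul_of_nonneg_left (norm_nystrom_le hS x) ht
  have h3 := norm_exp_sub_sum_le _ h2 (K + 1)
  calc ‖E - Y‖ = ‖(E - NormedSpace.exp ((Complex.I * (t : ℂ)) • N)) +
        (NormedSpace.exp ((Complex.I * (t : ℂ)) • N) - Y)‖ := by rw [sub_add_sub_cancel]
    _ ≤ _ := (norm_add_le _ _).trans (add_le_add h1 h3)

end

/-! ### The law of the sampled tuple -/

theorem measureReal_tuple_eq {ι : Type*} [Fintype ι] [MeasurableSpace ι]
    [MeasurableSingletonClass ι] {Ω : Type*} [MeasurableSpace Ω] {μ : Measure Ω} {M : ℕ}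
    {H : Matrix ι ι ℂ} {T : Fin M → Ω → ι} (hT : IsDiagonalSample μ H T) (x : Fin M → ι) :
    μ.real {ω | (fun j => T j ω) = x} = ∏ j, sampleProb H (x j) := by
  have h := hT.indep.measure_inter_preimage_eq_mul Finset.univ (sets := fun j => {x j})
    (fun j _ => measurableSet_singleton _)
  have e : {ω | (fun j => T j ω) = x} = ⋂ j ∈ Finset.univ, T j ⁻¹' {x j} := by
    ext ω; simp [funext_iff]
  rw [e, Measure.real, h, ENNReal.toReal_prod]
  exact Finset.prod_congr rfl fun j _ => hT.law j (x j)

/-- Markov's inequality for a nonnegative function of the sampled tuple. -/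
theorem mul_measureReal_lt_le {ι : Type*} [Fintype ι] [MeasurableSpace ι]
    [MeasurableSingletonClass ι] {Ω : Type*} [MeasurableSpace Ω] {μ : Measure Ω}
    [IsProbabilityMeasure μ] {M : ℕ} {H : Matrix ι ι ℂ} {T : Fin M → Ω → ι}
    (hT : IsDiagonalSample μ H T) {f : (Fin M → ι) → ℝ} (hf : ∀ x, 0 ≤ f x) {r : ℝ} (hr : 0 ≤ r) :
    r * μ.real {ω | r < f fun j => T j ω} ≤ ∑ x, (∏ j, sampleProb H (x j)) * f x := by
  classical
  have e : {ω | r < f fun j => T j ω} =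
      ⋃ x ∈ Finset.univ.filter (fun x => r < f x), {ω | (fun j => T j ω) = x} := by
    ext ω; simp
  have hp : ∀ x : Fin M → ι, 0 ≤ ∏ j, sampleProb H (x j) := fun x => by
    rw [← measureReal_tuple_eq hT]; exact measureReal_nonneg
  calc r * μ.real {ω | r < f fun j => T j ω}
      ≤ r * ∑ x ∈ Finset.univ.filter (fun x => r < f x), ∏ j, sampleProb H (x j) := by
        rw [e]
        refine mul_le_mul_of_nonneg_left ((measureReal_biUnion_finset_le _ _).trans_eq ?_) hr
        exact Finset.sum_congr rfl fun x _ => measureReal_tuple_eq hT x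
    _ ≤ ∑ x ∈ Finset.univ.filter (fun x => r < f x), (∏ j, sampleProb H (x j)) * f x := by
        rw [Finset.mul_sum]
        refine Finset.sum_le_sum fun x hx => ?_
        rw [mul_comm]
        exact mul_le_mul_of_nonneg_left (Finset.mem_filter.mp hx).2.le (hp x)
    _ ≤ _ := Finset.sum_le_sum_of_subset_of_nonneg (Finset.filter_subset _ _)
        fun x _ _ => mul_nonneg (hp x) (hf x)

/-! ### The numerical conditions on `K` and `M` -/

theorem exp_truncation_le {ε r : ℝ} (hε : 0 < ε) {K : ℕ}
    (hK : Real.exp 1 * r + Real.log (2 / ε) ≤ K) :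
    Real.exp (Real.exp 1 * r - (K + 1 : ℕ)) ≤ ε / 2 := by
  rw [← Real.le_log_iff_exp_le (by positivity), ← inv_div, Real.log_inv]
  push_cast
  linarith

/-- The condition on `M` makes the Markov bound at most `δ`. The assumption `ε / (2 t) < τ`
keeps the logarithm nonnegative. -/
theorem exp_sampling_le {τ t ε δ : ℝ} {M : ℕ} (ht : 0 < t) (hε : ε ∈ Set.Ioc (0 : ℝ) 1)
    (hδ : δ ∈ Set.Ioc (0 : ℝ) 1) (hτ : ε / (2 * t) < τ)
    (hM : 72 * τ * t / ε * Real.log (36 * τ * t / (ε * δ)) ≤ M) :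
    Real.exp (-(ε / (6 * t)) / τ) ^ M * τ ≤ 2 * (ε / (6 * t)) * δ := by
  obtain ⟨hε0, -⟩ := hε
  obtain ⟨hδ0, hδ1⟩ := hδ
  have hτ0 : 0 < τ := lt_trans (by positivity) hτ
  rw [div_lt_iff₀ (by positivity)] at hτ
  set L := Real.log (36 * τ * t / (ε * δ)) with hL
  have hL0 : 0 ≤ L := by
    refine Real.log_nonneg ?_
    rw [le_div_iff₀ (by positivity)]
    nlinarith [mul_le_mul_of_nonneg_left hδ1 hε0.le]
  have h1 : L ≤ M * (ε / (6 * t) / τ) := by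
    have h := mul_le_mul_of_nonneg_right hM (show 0 ≤ ε / (6 * t) / τ by positivity)
    have e : 72 * τ * t / ε * L * (ε / (6 * t) / τ) = 12 * L := by field_simp; ring
    rw [e] at h
    linarith
  have h2 : Real.exp (-(ε / (6 * t)) / τ) ^ M ≤ ε * δ / (36 * τ * t) := by
    rw [← Real.exp_nat_mul, ← Real.le_log_iff_exp_le (by positivity), ← inv_div (36 * τ * t),
      Real.log_inv, neg_div, mul_neg]
    exact neg_le_neg h1
  calc _ ≤ ε * δ / (36 * τ * t) * τ := mul_le_mul_of_nonneg_right h2 hτ0.le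
    _ = ε * δ / t * (1 / 36) := by field_simp
    _ ≤ ε * δ / t * (1 / 3) := by gcongr; norm_num
    _ = _ := by field_simp; norm_num

section

open scoped MatrixOrder Matrix.Norms.L2Operator

/-- With probability at least `1 - δ` the Nyström residual has norm at most `ε / (2 t)`. If
`tr H ≤ ε / (2 t)` this holds for every sample. -/
theorem one_sub_le_measureReal_nystrom {ι : Type*} [Fintype ι] [DecidableEq ι] [MeasurableSpace ι]
    [MeasurableSingletonClass ι] {Ω : Type*} [MeasurableSpace Ω] {μ : Measure Ω}
    [IsProbabilityMeasure μ] {M : ℕ} {S : Matrix ι ι ℂ} (hS : star S = S) {T : Fin M → Ω → ι}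
    (hT : IsDiagonalSample μ (S * S) T) {t ε δ : ℝ} (ht : 0 < t) (hε : ε ∈ Set.Ioc (0 : ℝ) 1)
    (hδ : δ ∈ Set.Ioc (0 : ℝ) 1)
    (hM : 72 * (S * S).trace.re * t / ε * Real.log (36 * (S * S).trace.re * t / (ε * δ)) ≤ M) :
    1 - δ ≤ μ.real {ω | ‖S * S - nystrom (S * S) (fun j => T j ω)‖ ≤ ε / (2 * t)} := by
  have hε0 := hε.1
  have hH : 0 ≤ S * S := by nth_rw 1 [← hS]; exact star_mul_self_nonneg S
  rcases le_or_gt (S * S).trace.re (ε / (2 * t)) with hτ | hτ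
  · have e : {ω | ‖S * S - nystrom (S * S) (fun j => T j ω)‖ ≤ ε / (2 * t)} = Set.univ :=
      Set.eq_univ_of_forall fun ω =>
        ((norm_sub_nystrom_le hS _).trans (norm_le_re_trace hH)).trans hτ
    rw [e, probReal_univ]
    linarith [hδ.1]
  · have hτ0 : 0 < (S * S).trace.re := lt_trans (by positivity) hτ
    -- Threshold `c = ε / (6 t)`: the potential is at most `2 c` with high probability, and then
    -- the residual is at most `3 c = ε / (2 t)`.
    set c := ε / (6 * t) with hc
    have hc0 : 0 < c := by positivity
    set f : (Fin M → ι) → ℝ := fun x =>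
      potential c (deflation S M x * (S * S) * deflation S M x) with hf
    have h1 := mul_measureReal_lt_le hT (f := f) (fun x => potential_nonneg _ _)
      (show 0 ≤ 2 * c by positivity)
    have h2 := (h1.trans (expected_potential_le hc0.le hS hτ0 M)).trans
      (exp_sampling_le ht hε hδ hτ hM)
    have h3 : μ.real {ω | 2 * c < f fun j => T j ω} ≤ δ := le_of_mul_le_mul_left h2 (by positivity)
    have h4 : Set.univ ⊆ {ω | ‖S * S - nystrom (S * S) (fun j => T j ω)‖ ≤ ε / (2 * t)} ∪
        {ω | 2 * c < f fun j => T j ω} := fun ω _ => by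
      rcases lt_or_ge (2 * c) (f fun j => T j ω) with h | h
      · exact Or.inr h
      · left
        have e : ε / (2 * t) = c + 2 * c := by rw [hc]; field_simp; norm_num
        rw [Set.mem_ofPred_eq, e]
        exact (norm_sub_nystrom_le_potential hc0.le hS _).trans (add_le_add_right h c)
    have h5 := (measureReal_mono (μ := μ) h4).trans (measureReal_union_le _ _)
    rw [probReal_univ] at h5
    linarith

/-- The statement for a general finite index set, with `H` given as the square of a Hermitian
matrix. -/
theorem one_sub_le_measureReal_output {ι : Type*} [Fintype ι] [DecidableEq ι] [MeasurableSpace ι]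
    [MeasurableSingletonClass ι] {Ω : Type*} [MeasurableSpace Ω] {μ : Measure Ω}
    [IsProbabilityMeasure μ] {K M : ℕ} {S : Matrix ι ι ℂ} (hS : star S = S) {T : Fin M → Ω → ι}
    (hT : IsDiagonalSample μ (S * S) T) {ψ : EuclideanSpace ℂ ι} (hψ : ‖ψ‖ = 1) {t ε δ : ℝ}
    (ht : 0 < t) (hε : ε ∈ Set.Ioc (0 : ℝ) 1) (hδ : δ ∈ Set.Ioc (0 : ℝ) 1)
    (hK : Real.exp 1 * t * specNorm (S * S) + Real.log (2 / ε) ≤ K)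
    (hM : 72 * (S * S).trace.re * t / ε * Real.log (36 * (S * S).trace.re * t / (ε * δ)) ≤ M) :
    1 - δ ≤ μ.real {ω | ‖evolve (S * S) t ψ - output (S * S) (fun j => T j ω) t K ψ‖ ≤ ε} := by
  refine (one_sub_le_measureReal_nystrom hS hT ht hε hδ hM).trans
    (measureReal_mono fun ω hω => ?_)
  have hK1 : 1 ≤ K := by
    have h1 : 0 < Real.log (2 / ε) :=
      Real.log_pos (by rw [lt_div_iff₀ hε.1]; linarith [hε.2])
    have h2 : 0 ≤ Real.exp 1 * t * specNorm (S * S) :=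
      mul_nonneg (by positivity) (norm_nonneg _)
    exact_mod_cast (by linarith : (0 : ℝ) < K)
  refine (norm_evolve_sub_output_le hS _ ht.le hK1 ψ hψ).trans ?_
  rw [mul_assoc] at hK
  have h1 := exp_truncation_le hε.1 hK
  have h2 := mul_le_mul_of_nonneg_left hω.out ht.le
  have e : t * (ε / (2 * t)) = ε / 2 := by field_simp
  linarith

theorem exists_sq_eq {ι : Type*} [Fintype ι] [DecidableEq ι] {H : Matrix ι ι ℂ}
    (hH : H.PosSemidef) : ∃ S : Matrix ι ι ℂ, star S = S ∧ S * S = H :=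
  ⟨CFC.sqrt H, (IsSelfAdjoint.of_nonneg (CFC.sqrt_nonneg H)).star_eq,
    CFC.sqrt_mul_sqrt_self H (nonneg_iff_posSemidef.mpr hH)⟩

end

end NystromSim

theorem theorem4 {n : ℕ} (H : Matrix (Fin (2 ^ n)) (Fin (2 ^ n)) ℂ) (hH : H.PosSemidef)
    (ψ : EuclideanSpace ℂ (Fin (2 ^ n))) (hψ : ‖ψ‖ = 1)
    (t ε δ : ℝ) (ht : 0 < t) (hε : ε ∈ Set.Ioc (0 : ℝ) 1) (hδ : δ ∈ Set.Ioc (0 : ℝ) 1)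
    (K M : ℕ)
    (hK : Real.exp 1 * t * NystromSim.specNorm H + Real.log (2 / ε) ≤ (K : ℝ))
    (hM : max (405 * H.trace.re)
        (72 * H.trace.re * t / ε * Real.log (36 * H.trace.re * t / (ε * δ))) ≤ (M : ℝ))
    {Ω : Type*} [MeasurableSpace Ω] (μ : Measure Ω) [IsProbabilityMeasure μ]
    (T : Fin M → Ω → Fin (2 ^ n)) (hT : NystromSim.IsDiagonalSample μ H T) :
    1 - δ ≤ μ.real {ω | ‖NystromSim.evolve H t ψ -
      NystromSim.output H (fun j => T j ω) t K ψ‖ ≤ ε} := by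
  obtain ⟨S, hS, rfl⟩ := NystromSim.exists_sq_eq hH
  exact NystromSim.one_sub_le_measureReal_output hS hT hψ ht hε hδ hK ((le_max_right _ _).trans hM)
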